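/- Let $n \ge 4$ and let $G=(X,Y;E)$ be a finite simple balanced bipartite graph of order $2n$ (so $|X|=|Y|=n$) with minimum degree $\delta \ge 2$ and $e$ edges. If $e \ge n^2-2n+4$, then $G$ is bipancyclic, that is, $G$ contains a cycle of every even length from $4$ to $2n$, or $G$ is isomorphic to the graph $G_1=(A,B;E_1)$ with $A=\{a_1,\dots,a_n\}$, $B=\{b_1,\dots,b_n\}$ and $$E_1=\{a_ib_j : 1\le i\le 2,\ n-1\le j\le n\}\cup\{a_ib_j : 3\le i\le n,\ 1\le j\le n\}.$$ -/

import Mathlib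

/-- `X` and `Y` are the two parts of a balanced bipartite graph `G`: together they partition the
vertex set, every edge joins a vertex of `X` to a vertex of `Y`, and the parts have equal size. -/
structure IsBalancedBipartition {V : Type*} [Fintype V] [DecidableEq V]
    (G : SimpleGraph V) (X Y : Finset V) : Prop where
  isBipartiteWith : G.IsBipartiteWith (X : Set V) (Y : Set V)
  union_eq_univ : X ∪ Y = Finset.univ
  card_eq : X.card = Y.card

/-- `G` contains a cycle of every even length from `4` to the number of its vertices. -/
def IsBipancyclic {V : Type*} [Fintype V] (G : SimpleGraph V) : Prop :=
  ∀ l : ℕ, Even l → 4 ≤ l → l ≤ Fintype.card V →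
    ∃ (v : V) (c : G.Walk v v), c.IsCycle ∧ c.length = l

/-- The edges of `graphG1 n`. The indices `i j : Fin n` stand for `a_{i+1}` and `b_{j+1}`, so
`a_{i+1} b_{j+1}` is an edge iff `i + 1 ≤ 2` and `n - 1 ≤ j + 1`, or `3 ≤ i + 1`. -/
def graphG1Edge (n : ℕ) (i j : Fin n) : Prop :=
  (i.val + 1 ≤ 2 ∧ n ≤ (j.val + 1) + 1) ∨ 3 ≤ i.val + 1

/-- The balanced bipartite graph `G₁` with parts `A = {a₁, …, aₙ}` (left summand) and
`B = {b₁, …, bₙ}` (right summand) and edges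
`{aᵢbⱼ : 1 ≤ i ≤ 2, n - 1 ≤ j ≤ n} ∪ {aᵢbⱼ : 3 ≤ i ≤ n, 1 ≤ j ≤ n}`. -/
def graphG1 (n : ℕ) : SimpleGraph (Fin n ⊕ Fin n) where
  Adj u v := match u, v with
    | Sum.inl i, Sum.inr j => graphG1Edge n i j
    | Sum.inr j, Sum.inl i => graphG1Edge n i j
    | _, _ => False
  symm := ⟨by rintro (i | i) (j | j) h <;> exact h⟩
  loopless := ⟨by rintro (i | i) h <;> exact h⟩

/-! The proof separates Hamiltonicity from the shorter cycles.

Hamiltonicity comes from the bipartite Bondy–Chvátal closure: joining a nonadjacent pair across the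
parts with degree sum at least `n + 1` does not affect whether `G` is Hamiltonian
(`exists_isHamiltonianEnum_of_sup_edge`). Once no such pair is left, either the graph is complete
bipartite or counting missing edges forces the extremal structure with exactly `n² - 2n + 4` edges
(`isExtremalBetween_of_degree_le`). An added edge pushes the count above this value, so the
exception can only be `G` itself.

Given a Hamiltonian cycle, a missing even length `l` makes every chord of span `l - 1` a non-edge
(`IsHamiltonianEnum.isBipancyclic`). This is too many non-edges, except in the antipodal case `l - 1
= n`, where pairs of shorter chords supply the cycle. -/

/-! ### Cyclic vertex sequences and Hamiltonian enumerations. -/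

/-- The values `f 0, …, f (l - 1)` run once around a cycle of length `l` in `G`. -/
structure IsCyclicSequence {V : Type*} (G : SimpleGraph V) (l : ℕ) (f : ℕ → V) : Prop where
  injOn : Set.InjOn f (Set.Iio l)
  adj : ∀ i, i + 1 < l → G.Adj (f i) (f (i + 1))
  closing : G.Adj (f (l - 1)) (f 0)

theorem IsCyclicSequence.exists_isCycle {V : Type*} {G : SimpleGraph V} {l : ℕ} {f : ℕ → V}
    (h : IsCyclicSequence G l f) (hl : 2 < l) :
    ∃ (v : V) (c : G.Walk v v), c.IsCycle ∧ c.length = l := by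
  have key : ∀ u v : Fin l, (v - u).val = 1 → G.Adj (f u) (f v) := by
    intro u v huv
    have hu := u.isLt
    have hv := v.isLt
    rw [Fin.val_sub] at huv
    rcases Nat.lt_or_ge v.val u.val with hlt | hge
    · rw [Nat.mod_eq_of_lt (by omega)] at huv
      have h0 : v.val = 0 := by omega
      have h1 : u.val = l - 1 := by omega
      rw [h0, h1]
      exact h.closing
    · rw [show l - u.val + v.val = (v.val - u.val) + l by omega, Nat.add_mod_right,
        Nat.mod_eq_of_lt (by omega)] at huv
      have h1 : v.val = u.val + 1 := by omega
      rw [h1]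
      exact h.adj _ (by omega)
  have hcopy : (SimpleGraph.cycleGraph l).IsContained G := by
    refine ⟨⟨⟨fun i => f i.val, ?_⟩, ?_⟩⟩
    · intro u v huv
      rw [SimpleGraph.cycleGraph_adj'] at huv
      rcases huv with huv | huv
      · exact (key v u huv).symm
      · exact key u v huv
    · intro u v huv
      exact Fin.ext (h.injOn u.isLt v.isLt huv)
  obtain ⟨v, c, hc, hlen⟩ := (SimpleGraph.cycleGraph_isContained_iff hl).1 hcopy
  exact ⟨v, c, hc, hlen⟩

/-- The cyclic enumeration `e` of the vertices of `G` is a Hamiltonian cycle. -/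
def IsHamiltonianEnum {V : Type*} (G : SimpleGraph V) {N : ℕ} (e : ZMod N ≃ V) : Prop :=
  ∀ i, G.Adj (e i) (e (i + 1))

theorem natCast_zmod_injOn (N : ℕ) : Set.InjOn (Nat.cast : ℕ → ZMod N) (Set.Iio N) := by
  intro a ha b hb hab
  rw [ZMod.natCast_eq_natCast_iff'] at hab
  rwa [Nat.mod_eq_of_lt ha, Nat.mod_eq_of_lt hb] at hab

/-- Listing vertices by their positions on an enumeration, measured from `i`. -/
theorem isCyclicSequence_of_reindex {V : Type*} {G : SimpleGraph V} {N l : ℕ} (e : ZMod N ≃ V)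
    (i : ZMod N) (σ : ℕ → ℕ) (hlt : ∀ j < l, σ j < N) (hσ : Set.InjOn σ (Set.Iio l))
    (hadj : ∀ j, j + 1 < l → G.Adj (e (i + σ j)) (e (i + σ (j + 1))))
    (hclose : G.Adj (e (i + σ (l - 1))) (e (i + σ 0))) :
    IsCyclicSequence G l (fun j => e (i + σ j)) := by
  refine ⟨?_, hadj, hclose⟩
  intro a ha b hb hab
  have h1 : ((σ a : ℕ) : ZMod N) = σ b := add_left_cancel (e.injective hab)
  exact hσ ha hb (natCast_zmod_injOn N (hlt a ha) (hlt b hb) h1)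

theorem IsHamiltonianEnum.adj_of_eq_add_one {V : Type*} {G : SimpleGraph V} {N : ℕ}
    {e : ZMod N ≃ V} (he : IsHamiltonianEnum G e) (i : ZMod N) {a b : ℕ} (h : b = a + 1) :
    G.Adj (e (i + a)) (e (i + b)) := by
  have := he (i + a)
  subst h
  rwa [add_assoc, ← Nat.cast_succ] at this

theorem IsCyclicSequence.exists_isHamiltonianEnum {V : Type*} [Fintype V] {G : SimpleGraph V}
    {N : ℕ} {f : ℕ → V} (h : IsCyclicSequence G N f) (hN : 2 ≤ N) (hV : Fintype.card V = N) :
    ∃ e : ZMod N ≃ V, IsHamiltonianEnum G e := by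
  have : NeZero N := ⟨by omega⟩
  have : Fact (1 < N) := ⟨by omega⟩
  have hinj : Function.Injective (fun i : ZMod N => f i.val) := by
    intro a b hab
    exact ZMod.val_injective N (h.injOn (ZMod.val_lt a) (ZMod.val_lt b) hab)
  have hbij := (Fintype.bijective_iff_injective_and_card _).2
    ⟨hinj, by rw [ZMod.card, hV]⟩
  refine ⟨Equiv.ofBijective _ hbij, fun i => ?_⟩
  simp only [Equiv.ofBijective_apply]
  have hi := ZMod.val_lt i
  rw [ZMod.val_add, ZMod.val_one]
  rcases Nat.lt_or_ge (i.val + 1) N with hlt | hge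
  · rw [Nat.mod_eq_of_lt hlt]
    exact h.adj _ hlt
  · have h1 : i.val + 1 = N := by omega
    rw [h1, Nat.mod_self, show i.val = N - 1 by omega]
    exact h.closing

/-- Two crossing chords turn a Hamiltonian path from `e 0` to `e (-1)` into a Hamiltonian cycle. -/
theorem exists_isHamiltonianEnum_of_crossing {V : Type*} [Fintype V] {G : SimpleGraph V}
    {N : ℕ} (hN : 2 ≤ N) (hV : Fintype.card V = N) (e : ZMod N ≃ V) (i : ZMod N)
    (hpath : ∀ k, k + 1 < N → G.Adj (e (i + k)) (e (i + (k + 1 : ℕ)))) {j : ℕ} (hj : j + 1 < N)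
    (h₁ : G.Adj (e (i + j)) (e (i + (N - 1 : ℕ))))
    (h₂ : G.Adj (e (i + (0 : ℕ))) (e (i + (j + 1 : ℕ)))) :
    ∃ e' : ZMod N ≃ V, IsHamiltonianEnum G e' := by
  -- The new cycle visits positions `0, …, j`, then `N - 1` down to `j + 1`.
  refine (isCyclicSequence_of_reindex (l := N) e i (fun k => if k ≤ j then k else N + j - k)
    ?_ ?_ ?_ ?_).exists_isHamiltonianEnum hN hV
  · intro k hk
    split_ifs <;> omega
  · intro a ha b hb hab
    simp only [Set.mem_Iio] at ha hb
    dsimp only at hab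
    split_ifs at hab <;> omega
  · intro k hk
    rcases Nat.lt_trichotomy k j with hlt | rfl | hgt
    · rw [if_pos (by omega), if_pos (by omega)]
      exact hpath k hk
    · rw [if_pos le_rfl, if_neg (by omega), show N + k - (k + 1) = N - 1 by omega]
      exact h₁
    · rw [if_neg (by omega), if_neg (by omega)]
      have := hpath (N + j - (k + 1)) (by omega)
      rw [show N + j - (k + 1) + 1 = N + j - k by omega] at this
      exact this.symm
  · rw [if_neg (by omega), if_pos (by omega), show N + j - (N - 1) = j + 1 by omega]
    exact h₂.symm

/-! ### Bipartite closure. -/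

section Closure

variable {V : Type*} [Fintype V] [DecidableEq V] {G : SimpleGraph V} {X Y : Finset V}

theorem IsBalancedBipartition.symm (hG : IsBalancedBipartition G X Y) :
    IsBalancedBipartition G Y X :=
  ⟨hG.isBipartiteWith.symm, by rw [Finset.union_comm, hG.union_eq_univ], hG.card_eq.symm⟩

theorem IsBalancedBipartition.mem_of_adj (hG : IsBalancedBipartition G X Y) {u v : V}
    (hu : u ∈ X) (h : G.Adj u v) : v ∈ Y :=
  hG.isBipartiteWith.mem_of_mem_adj hu h

theorem IsBalancedBipartition.disjoint (hG : IsBalancedBipartition G X Y) : Disjoint X Y :=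
  Finset.disjoint_coe.1 hG.isBipartiteWith.disjoint

theorem IsBalancedBipartition.notMem (hG : IsBalancedBipartition G X Y) {v : V} (hv : v ∈ X) :
    v ∉ Y :=
  Finset.disjoint_left.1 hG.disjoint hv

theorem IsBalancedBipartition.mem_or_mem (hG : IsBalancedBipartition G X Y) (v : V) :
    v ∈ X ∨ v ∈ Y := by
  rw [← Finset.mem_union, hG.union_eq_univ]
  exact Finset.mem_univ v

theorem IsBalancedBipartition.card_eq_two_mul (hG : IsBalancedBipartition G X Y) :
    Fintype.card V = 2 * X.card := by
  rw [← Finset.card_univ, ← hG.union_eq_univ, Finset.card_union_of_disjoint hG.disjoint,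
    ← hG.card_eq, two_mul]

theorem IsBalancedBipartition.sup_edge (hG : IsBalancedBipartition G X Y) {x y : V}
    (hx : x ∈ X) (hy : y ∈ Y) : IsBalancedBipartition (G ⊔ SimpleGraph.edge x y) X Y := by
  refine ⟨⟨hG.isBipartiteWith.disjoint, ?_⟩, hG.union_eq_univ, hG.card_eq⟩
  intro v w h
  rw [SimpleGraph.sup_adj, SimpleGraph.edge_adj] at h
  rcases h with h | ⟨⟨rfl, rfl⟩ | ⟨rfl, rfl⟩, -⟩
  · exact hG.isBipartiteWith.mem_of_adj h
  · exact Or.inl ⟨hx, hy⟩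
  · exact Or.inr ⟨hy, hx⟩

variable [DecidableRel G.Adj]

/-- Ore's argument inside one part: the path predecessors of the neighbours of `e (i + 1)` and the
neighbours of `e i` all lie in `Y`. Their numbers add up to more than `|Y|`, so they share a vertex,
which yields two crossing chords. -/
theorem exists_isHamiltonianEnum_of_path {N : ℕ} (hN : 2 ≤ N) (hV : Fintype.card V = N)
    (hG : IsBalancedBipartition G X Y) (e : ZMod N ≃ V) (i : ZMod N)
    (hpath : ∀ k ≠ i, G.Adj (e k) (e (k + 1))) (hx : e i ∈ X) (hy : e (i + 1) ∈ Y)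
    (hdeg : X.card + 1 ≤ G.degree (e i) + G.degree (e (i + 1))) :
    ∃ e' : ZMod N ≃ V, IsHamiltonianEnum G e' := by
  have : NeZero N := ⟨by omega⟩
  have hlast : i + 1 + ((N - 1 : ℕ) : ZMod N) = i := by
    rw [add_assoc, add_comm (1 : ZMod N), ← Nat.cast_succ, show (N - 1).succ = N by omega,
      ZMod.natCast_self, add_zero]
  set A := (G.neighborFinset (e (i + 1))).image (fun v => e (e.symm v - 1)) with hA
  have hAcard : A.card = G.degree (e (i + 1)) := by
    rw [hA, Finset.card_image_of_injective, SimpleGraph.card_neighborFinset_eq_degree]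
    intro a b hab
    exact e.symm.injective (sub_left_injective (e.injective hab))
  have hAY : A ⊆ Y := by
    intro u hu
    obtain ⟨v, hv, rfl⟩ := Finset.mem_image.1 hu
    rw [SimpleGraph.mem_neighborFinset] at hv
    have hne : e.symm v - 1 ≠ i := by
      intro h
      rw [sub_eq_iff_eq_add] at h
      rw [← h, e.apply_symm_apply] at hv
      exact G.loopless.irrefl v hv
    have h := hpath _ hne
    rw [sub_add_cancel, e.apply_symm_apply] at h
    exact hG.mem_of_adj (hG.symm.mem_of_adj hy hv) h.symm
  have hBY : G.neighborFinset (e i) ⊆ Y := fun u hu =>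
    hG.mem_of_adj hx ((SimpleGraph.mem_neighborFinset _ _ _).1 hu)
  have hinter : (A ∩ G.neighborFinset (e i)).Nonempty := by
    rw [← Finset.card_pos]
    have h1 := Finset.card_union_add_card_inter A (G.neighborFinset (e i))
    have h2 := Finset.card_le_card (Finset.union_subset hAY hBY)
    have h3 := hG.card_eq
    rw [hAcard, SimpleGraph.card_neighborFinset_eq_degree] at h1
    omega
  obtain ⟨u, hu⟩ := hinter
  rw [Finset.mem_inter, SimpleGraph.mem_neighborFinset] at hu
  obtain ⟨huA, hux⟩ := hu
  have huY := hAY huA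
  obtain ⟨v, hv, hvu⟩ := Finset.mem_image.1 huA
  rw [SimpleGraph.mem_neighborFinset] at hv
  set j := (e.symm u - (i + 1)).val with hjdef
  have hj : i + 1 + (j : ZMod N) = e.symm u := by
    rw [hjdef, ZMod.natCast_zmod_val]; abel
  have hvpos : e.symm v = e.symm u + 1 := by
    rw [← hvu, e.symm_apply_apply]; abel
  have hjN : j + 1 < N := by
    have h1 : j < N := ZMod.val_lt _
    by_contra hcon
    have h2 : j = N - 1 := by omega
    rw [h2, hlast] at hj
    rw [hj, e.apply_symm_apply] at hx
    exact hG.notMem hx huY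
  refine exists_isHamiltonianEnum_of_crossing hN hV e (i + 1) ?_ hjN ?_ ?_
  · intro k hk
    rw [Nat.cast_succ, ← add_assoc]
    refine hpath _ fun h => ?_
    have h' : ((k : ℕ) : ZMod N) = ((N - 1 : ℕ) : ZMod N) :=
      add_left_cancel (h.trans hlast.symm)
    have := natCast_zmod_injOn N (show k < N by omega) (show N - 1 < N by omega) h'
    omega
  · rw [hj, hlast, e.apply_symm_apply]
    exact hux.symm
  · rw [Nat.cast_zero, add_zero, Nat.cast_succ, ← add_assoc, hj, ← hvpos, e.apply_symm_apply]
    exact hv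

/-- The bipartite closure step of Bondy and Chvátal. -/
theorem exists_isHamiltonianEnum_of_sup_edge {N : ℕ} (hN : 3 ≤ N) (hV : Fintype.card V = N)
    (hG : IsBalancedBipartition G X Y) {x y : V} (hx : x ∈ X) (hy : y ∈ Y)
    (hdeg : X.card + 1 ≤ G.degree x + G.degree y) {e : ZMod N ≃ V}
    (he : IsHamiltonianEnum (G ⊔ SimpleGraph.edge x y) e) :
    ∃ e' : ZMod N ≃ V, IsHamiltonianEnum G e' := by
  by_cases hall : IsHamiltonianEnum G e
  · exact ⟨e, hall⟩
  obtain ⟨i, hi⟩ := not_forall.1 hall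
  have hnew : ∀ k, ¬ G.Adj (e k) (e (k + 1)) →
      (x = e k ∧ y = e (k + 1)) ∨ (x = e (k + 1) ∧ y = e k) := by
    intro k hk
    have h := he k
    rw [SimpleGraph.sup_adj, SimpleGraph.edge_adj] at h
    exact (h.resolve_left hk).1.imp (fun h => ⟨h.1.symm, h.2.symm⟩) fun h => ⟨h.2.symm, h.1.symm⟩
  have htwo : (1 : ZMod N) + 1 ≠ 0 := by
    intro h
    have h' : ((2 : ℕ) : ZMod N) = ((0 : ℕ) : ZMod N) := by
      rw [Nat.cast_zero, ← h]; norm_num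
    have := natCast_zmod_injOn N (show 2 < N by omega) (show 0 < N by omega) h'
    omega
  -- The cycle uses the new edge only once: a second use would have to traverse it backwards, giving
  -- `2 = 0` in `ZMod N`.
  have hpath : ∀ k ≠ i, G.Adj (e k) (e (k + 1)) := by
    intro k hki
    by_contra hk
    have cross : e k = e (i + 1) → e (k + 1) = e i → False := by
      intro h1 h2
      have h1 := e.injective h1
      have h2 := e.injective h2
      rw [h1, add_assoc] at h2
      exact htwo (by simpa using h2)
    rcases hnew k hk with ⟨h1, h2⟩ | ⟨h1, h2⟩ <;> rcases hnew i hi with ⟨h3, h4⟩ | ⟨h3, h4⟩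
    · exact hki (e.injective (h1.symm.trans h3))
    · exact cross (h1.symm.trans h3) (h2.symm.trans h4)
    · exact cross (h2.symm.trans h4) (h1.symm.trans h3)
    · exact hki (e.injective (h2.symm.trans h4))
  rcases hnew i hi with ⟨h1, h2⟩ | ⟨h1, h2⟩
  · refine exists_isHamiltonianEnum_of_path (by omega) hV hG e i hpath (h1 ▸ hx) (h2 ▸ hy) ?_
    rwa [← h1, ← h2]
  · refine exists_isHamiltonianEnum_of_path (by omega) hV hG.symm e i hpath (h2 ▸ hy) (h1 ▸ hx) ?_
    rw [← h1, ← h2, ← hG.card_eq]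
    omega

end Closure

/-! ### Closed graphs that are not complete. -/

section Extremal

variable {V : Type*} [Fintype V] [DecidableEq V] {G : SimpleGraph V} {X Y : Finset V}

/-- `G` is complete between `X` and `Y`, except that two vertices of `X` are adjacent to just the
same two vertices of `Y`. -/
def IsExtremalBetween (G : SimpleGraph V) (X Y : Finset V) : Prop :=
  ∃ S ⊆ X, ∃ U ⊆ Y, S.card = 2 ∧ U.card = 2 ∧ ∀ x ∈ X, ∀ y ∈ Y, G.Adj x y ↔ (x ∈ S → y ∈ U)

variable [DecidableRel G.Adj]

theorem IsBalancedBipartition.degree_add_card_filter_not_adj (hG : IsBalancedBipartition G X Y)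
    {x : V} (hx : x ∈ X) :
    G.degree x + (Y.filter fun y => ¬ G.Adj x y).card = X.card := by
  rw [← SimpleGraph.card_neighborFinset_eq_degree,
    SimpleGraph.isBipartiteWith_neighborFinset hG.isBipartiteWith hx,
    Finset.card_filter_add_card_filter_not, hG.card_eq]

/-- Put `k = deg x` and `r = n - k`. At least `k` vertices of `X` miss `y`, each of degree at most
`k`, so at least `k * r` pairs are missing, while at most `2n - 4` may be. Since `k * r - (2n - 4) =
(k - 2) * (r - 2)` and `r ≥ k`, this forces `k = 2` and equality throughout. -/
theorem isExtremalBetween_of_degree_le (hG : IsBalancedBipartition G X Y) {n : ℕ}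
    (hX : X.card = n) (hn : 4 ≤ n) (hδ : ∀ v, 2 ≤ G.degree v)
    (he : n ^ 2 + 4 ≤ G.edgeFinset.card + 2 * n) {x y : V} (hx : x ∈ X) (hy : y ∈ Y)
    (hsum : G.degree x + G.degree y ≤ n) (hle : G.degree x ≤ G.degree y)
    (hmaxx : ∀ x' ∈ X, ¬ G.Adj x' y → G.degree x' ≤ G.degree x)
    (hmaxy : ∀ y' ∈ Y, ¬ G.Adj x y' → G.degree y' ≤ G.degree y) :
    IsExtremalBetween G X Y ∧ G.edgeFinset.card + 2 * n = n ^ 2 + 4 := by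
  set S := X.filter fun x' => ¬ G.Adj y x' with hS
  set m : V → ℕ := fun v => (Y.filter fun y' => ¬ G.Adj v y').card with hm
  have hSX : S ⊆ X := Finset.filter_subset _ _
  have hdm : ∀ v ∈ X, G.degree v + m v = n := fun v hv => by
    rw [hm, hG.degree_add_card_filter_not_adj hv, hX]
  have hScard : G.degree y + S.card = n := by
    rw [hS, hG.symm.degree_add_card_filter_not_adj hy, ← hG.card_eq, hX]
  have htotal : G.edgeFinset.card + ∑ v ∈ X, m v = n ^ 2 := by
    rw [← SimpleGraph.isBipartiteWith_sum_degrees_eq_card_edges hG.isBipartiteWith,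
      ← Finset.sum_add_distrib, Finset.sum_congr rfl hdm, Finset.sum_const, hX, smul_eq_mul, sq]
  have hsplit := Finset.sum_sdiff (f := m) hSX
  have hSdeg : ∀ s ∈ S, G.degree s ≤ G.degree x := fun s hs => by
    rw [hS, Finset.mem_filter] at hs
    exact hmaxx s hs.1 fun h => hs.2 h.symm
  have hSsum : S.card * (n - G.degree x) ≤ ∑ v ∈ S, m v := by
    rw [← smul_eq_mul, ← Finset.sum_const]
    refine Finset.sum_le_sum fun s hs => ?_
    have h1 := hSdeg s hs
    have h2 := hdm s (hSX hs)
    omega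
  obtain ⟨r, hr⟩ : ∃ r, n = G.degree x + r := ⟨n - G.degree x, by omega⟩
  have hxr : n - G.degree x = r := by omega
  rw [hxr] at hSsum
  have hx2 := hδ x
  have hSx : G.degree x ≤ S.card := by omega
  have hdx : G.degree x = 2 := by
    by_contra hne
    obtain ⟨p, hp⟩ : ∃ p, G.degree x = 3 + p := ⟨G.degree x - 3, by omega⟩
    obtain ⟨q, hq⟩ : ∃ q, r = 3 + p + q := ⟨r - (3 + p), by omega⟩
    have h1 : G.degree x * r ≤ S.card * r := Nat.mul_le_mul_right _ hSx
    rw [hp, hq] at h1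
    rw [hq] at hSsum
    have hsmall : ∑ v ∈ X, m v + 4 ≤ 2 * n := by linarith
    nlinarith [Nat.zero_le (p * q), Nat.zero_le (p * p), Nat.zero_le (∑ v ∈ X \ S, m v)]
  have hS2 : S.card = 2 := by
    by_contra hne
    have h1 : 3 * r ≤ S.card * r := Nat.mul_le_mul_right _ (by omega)
    omega
  rw [hS2] at hSsum
  have hrest : ∑ v ∈ X \ S, m v = 0 := by omega
  have hfull : ∀ v ∈ X, v ∉ S → ∀ w ∈ Y, G.Adj v w := by
    intro v hv hvS w hw
    have h0 := (Finset.sum_eq_zero_iff.1 hrest) v (Finset.mem_sdiff.2 ⟨hv, hvS⟩)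
    rw [hm] at h0
    have h1 := Finset.filter_eq_empty_iff.1 (Finset.card_eq_zero.1 h0) hw
    exact not_not.1 h1
  have hXS : (X \ S).card = n - 2 := by
    rw [Finset.card_sdiff_of_subset hSX, hX, hS2]
  -- Such a `w` would have degree at least `n - 1`, beating `deg y = n - 2` against the maximality
  -- of `y`.
  have hoff : ∀ w ∈ Y, ¬ G.Adj x w → ∀ s ∈ S, ¬ G.Adj s w := by
    intro w hw hxw s hs hsw
    have h1 : insert s (X \ S) ⊆ G.neighborFinset w := by
      intro v hv
      rw [SimpleGraph.mem_neighborFinset]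
      rcases Finset.mem_insert.1 hv with rfl | hv
      · exact hsw.symm
      · rw [Finset.mem_sdiff] at hv
        exact (hfull v hv.1 hv.2 w hw).symm
    have h2 := Finset.card_le_card h1
    rw [Finset.card_insert_of_notMem (by simp [hs]), SimpleGraph.card_neighborFinset_eq_degree,
      hXS] at h2
    have h3 := hmaxy w hw hxw
    omega
  have hNx : G.neighborFinset x ⊆ Y := fun w hw =>
    hG.mem_of_adj hx ((SimpleGraph.mem_neighborFinset _ _ _).1 hw)
  refine ⟨⟨S, hSX, G.neighborFinset x, hNx, hS2, ?_, ?_⟩, by omega⟩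
  · rw [SimpleGraph.card_neighborFinset_eq_degree, hdx]
  · intro v hv w hw
    constructor
    · intro hvw hvS
      rw [SimpleGraph.mem_neighborFinset]
      by_contra hxw
      exact hoff w hw hxw v hvS hvw
    · intro h
      by_cases hvS : v ∈ S
      · have h1 : G.neighborFinset v ⊆ G.neighborFinset x := by
          intro w' hw'
          rw [SimpleGraph.mem_neighborFinset] at hw' ⊢
          by_contra hxw
          exact hoff w' (hG.mem_of_adj hv hw') hxw v hvS hw'
        have h2 := Finset.eq_of_subset_of_card_le h1 (by
          rw [SimpleGraph.card_neighborFinset_eq_degree, SimpleGraph.card_neighborFinset_eq_degree,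
            hdx]
          exact hδ v)
        have h3 := h hvS
        rwa [← h2, SimpleGraph.mem_neighborFinset] at h3
      · exact hfull v hv hvS w hw

theorem isExtremalBetween_of_forall_degree_add_degree_le (hG : IsBalancedBipartition G X Y)
    {n : ℕ} (hX : X.card = n) (hn : 4 ≤ n) (hδ : ∀ v, 2 ≤ G.degree v)
    (he : n ^ 2 + 4 ≤ G.edgeFinset.card + 2 * n)
    (hdeg : ∀ x ∈ X, ∀ y ∈ Y, ¬ G.Adj x y → G.degree x + G.degree y ≤ n)
    (hnot : ∃ x ∈ X, ∃ y ∈ Y, ¬ G.Adj x y) :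
    (IsExtremalBetween G X Y ∨ IsExtremalBetween G Y X) ∧
      G.edgeFinset.card + 2 * n = n ^ 2 + 4 := by
  obtain ⟨x₀, hx₀, y₀, hy₀, h₀⟩ := hnot
  -- Maximising the degree sum over nonadjacent pairs makes each endpoint maximal among the
  -- non-neighbours of the other.
  obtain ⟨⟨x, y⟩, hxy, hmax⟩ := Finset.exists_max_image
    ((X ×ˢ Y).filter fun p => ¬ G.Adj p.1 p.2) (fun p => G.degree p.1 + G.degree p.2)
    ⟨(x₀, y₀), by simp [hx₀, hy₀, h₀]⟩
  simp only [Finset.mem_filter, Finset.mem_product, and_imp, Prod.forall] at hxy hmax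
  obtain ⟨⟨hx, hy⟩, hna⟩ := hxy
  have hmaxx : ∀ x' ∈ X, ¬ G.Adj x' y → G.degree x' ≤ G.degree x := fun x' hx' h => by
    have := hmax x' y hx' hy h
    omega
  have hmaxy : ∀ y' ∈ Y, ¬ G.Adj x y' → G.degree y' ≤ G.degree y := fun y' hy' h => by
    have := hmax x y' hx hy' h
    omega
  have hsum := hdeg x hx y hy hna
  rcases le_total (G.degree x) (G.degree y) with hle | hle
  · have h := isExtremalBetween_of_degree_le hG hX hn hδ he hx hy hsum hle hmaxx hmaxy
    exact ⟨Or.inl h.1, h.2⟩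
  · have h := isExtremalBetween_of_degree_le hG.symm (hG.card_eq ▸ hX) hn hδ he hy hx
      (by omega) hle (fun y' hy' h => hmaxy y' hy' fun h' => h h'.symm)
      (fun x' hx' h => hmaxx x' hx' fun h' => h h'.symm)
    exact ⟨Or.inr h.1, h.2⟩

end Extremal

/-! ### Uniqueness of the extremal graph. -/

section Isomorphism

theorem exists_equiv_of_card_fiber_eq {α β γ : Type*} [Fintype α] [Fintype β] [DecidableEq γ]
    (c : α → γ) (c' : β → γ)
    (h : ∀ k, (Finset.univ.filter fun a => c a = k).card =
      (Finset.univ.filter fun b => c' b = k).card) :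
    ∃ e : α ≃ β, ∀ a, c' (e a) = c a := by
  have hk : ∀ k, Nonempty ({a // c a = k} ≃ {b // c' b = k}) := fun k =>
    ⟨Fintype.equivOfCardEq (by rw [Fintype.card_subtype, Fintype.card_subtype, h k])⟩
  refine ⟨(Equiv.sigmaFiberEquiv c).symm.trans ((Equiv.sigmaCongrRight fun k => (hk k).some).trans
    (Equiv.sigmaFiberEquiv c')), fun a => ?_⟩
  exact ((hk (c a)).some ⟨a, rfl⟩).2

/-- Adjacency in an extremal graph depends only on the side of a vertex and on whether it is one of
the two distinguished vertices of its side. -/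
theorem IsExtremalBetween.exists_coloring {V : Type*} [Fintype V] [DecidableEq V]
    {G : SimpleGraph V} {X Y : Finset V} {n : ℕ} (hG : IsBalancedBipartition G X Y)
    (hX : X.card = n) (h : IsExtremalBetween G X Y) :
    ∃ c : V → Bool × Bool,
      (∀ k, (Finset.univ.filter fun v => c v = k).card = bif k.2 then 2 else n - 2) ∧
      ∀ u v, G.Adj u v ↔ (c u).1 ≠ (c v).1 ∧
        ((c u).1 = true → (c u).2 = true → (c v).2 = true) ∧
        ((c v).1 = true → (c v).2 = true → (c u).2 = true) := by
  obtain ⟨S, hS, U, hU, hS2, hU2, hadj⟩ := h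
  have hY : Y.card = n := hG.card_eq ▸ hX
  have hXY : ∀ v, v ∈ Y ↔ v ∉ X := fun v =>
    ⟨hG.symm.notMem, fun hv => (hG.mem_or_mem v).resolve_left hv⟩
  have hUX : ∀ v ∈ U, v ∉ X := fun v hv => (hXY v).1 (hU hv)
  refine ⟨fun v => (decide (v ∈ X), decide (v ∈ S ∪ U)), ?_, ?_⟩
  · have key : ∀ (p : V → Prop) [DecidablePred p] (A : Finset V), (∀ v, p v ↔ v ∈ A) →
        (Finset.univ.filter p).card = A.card := fun p _ A hA => by
      congr 1; ext v; simp [hA]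
    rintro ⟨_ | _, _ | _⟩
    · rw [key _ (Y \ U), Finset.card_sdiff_of_subset hU, hY, hU2]; · rfl
      intro v
      have := hXY v
      have : v ∈ S → v ∈ X := fun hv => hS hv
      simp only [Prod.mk.injEq, decide_eq_false_iff_not, Finset.mem_union, Finset.mem_sdiff]
      tauto
    · rw [key _ U, hU2]; · rfl
      intro v
      have := hUX v
      have : v ∈ S → v ∈ X := fun hv => hS hv
      simp only [Prod.mk.injEq, decide_eq_false_iff_not, decide_eq_true_eq, Finset.mem_union]
      tauto
    · rw [key _ (X \ S), Finset.card_sdiff_of_subset hS, hX, hS2]; · rfl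
      intro v
      have := hUX v
      simp only [Prod.mk.injEq, decide_eq_false_iff_not, decide_eq_true_eq, Finset.mem_union,
        Finset.mem_sdiff]
      tauto
    · rw [key _ S, hS2]; · rfl
      intro v
      have := hUX v
      have : v ∈ S → v ∈ X := fun hv => hS hv
      simp only [Prod.mk.injEq, decide_eq_true_eq, Finset.mem_union]
      tauto
  · have hSX : ∀ v, v ∈ S → v ∈ X := fun v hv => hS hv
    intro u v
    simp only [ne_eq, decide_eq_decide, decide_eq_true_eq, Finset.mem_union]
    have h1 := hSX u
    have h2 := hSX v
    have h3 := hUX u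
    have h4 := hUX v
    by_cases hu : u ∈ X <;> by_cases hv : v ∈ X
    · have : ¬ G.Adj u v := fun h => hG.notMem hv (hG.mem_of_adj hu h)
      tauto
    · have := hadj u hu v ((hXY v).2 hv)
      tauto
    · have := hadj v hv u ((hXY u).2 hu)
      rw [G.adj_comm]
      tauto
    · have : ¬ G.Adj u v := fun h => hv (hG.symm.mem_of_adj ((hXY u).2 hu) h)
      tauto

/-- The colour classes have sizes determined by `n`, and the colours determine adjacency, so any
colour-preserving bijection is an isomorphism. -/
theorem IsExtremalBetween.nonempty_iso {V W : Type*} [Fintype V] [DecidableEq V] [Fintype W]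
    [DecidableEq W] {G : SimpleGraph V} {H : SimpleGraph W} {X Y : Finset V} {A B : Finset W}
    (hG : IsBalancedBipartition G X Y) (hH : IsBalancedBipartition H A B)
    (hcard : X.card = A.card) (h : IsExtremalBetween G X Y) (h' : IsExtremalBetween H A B) :
    Nonempty (G ≃g H) := by
  obtain ⟨c, hc, hcadj⟩ := h.exists_coloring hG hcard
  obtain ⟨c', hc', hcadj'⟩ := h'.exists_coloring hH rfl
  obtain ⟨e, he⟩ := exists_equiv_of_card_fiber_eq c c' fun k => by rw [hc, hc']
  refine ⟨⟨e, ?_⟩⟩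
  intro u v
  rw [hcadj', hcadj, he, he]

theorem isBalancedBipartition_graphG1 (n : ℕ) :
    IsBalancedBipartition (graphG1 n) (Finset.univ.map Function.Embedding.inl)
      (Finset.univ.map Function.Embedding.inr) := by
  refine ⟨⟨?_, ?_⟩, ?_, by simp⟩
  · rw [Finset.disjoint_coe, Finset.disjoint_left]
    rintro (i | j) h <;> simp at h ⊢
  · rintro (i | j) (i' | j') h <;> simp [graphG1] at h ⊢
  · ext (i | j) <;> simp

theorem isExtremalBetween_graphG1 {n : ℕ} (hn : 2 ≤ n) :
    IsExtremalBetween (graphG1 n) (Finset.univ.map Function.Embedding.inl)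
      (Finset.univ.map Function.Embedding.inr) := by
  refine ⟨{Sum.inl ⟨0, by omega⟩, Sum.inl ⟨1, by omega⟩}, ?_,
    {Sum.inr ⟨n - 2, by omega⟩, Sum.inr ⟨n - 1, by omega⟩}, ?_, ?_, ?_, ?_⟩
  · intro v hv
    simp only [Finset.mem_insert, Finset.mem_singleton] at hv
    rcases hv with rfl | rfl <;> simp
  · intro v hv
    simp only [Finset.mem_insert, Finset.mem_singleton] at hv
    rcases hv with rfl | rfl <;> simp
  · exact Finset.card_pair (by simp)
  · refine Finset.card_pair fun h => ?_
    simp only [Sum.inr.injEq, Fin.mk.injEq] at h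
    omega
  · simp only [Finset.mem_map, Finset.mem_univ, true_and, Function.Embedding.inl_apply,
      Function.Embedding.inr_apply, forall_exists_index, forall_apply_eq_imp_iff]
    intro i j
    simp only [graphG1, graphG1Edge, Finset.mem_insert, Finset.mem_singleton, Sum.inl.injEq,
      Sum.inr.injEq, Fin.ext_iff]
    have := j.isLt
    omega

end Isomorphism

/-! ### Counting missing chords by span. -/

section MissingChords

variable {V : Type*} {G : SimpleGraph V} [DecidableRel G.Adj] {N : ℕ} [NeZero N]

/-- The number of positions `i` for which the chord from `e i` to `e (i + d)` is missing. -/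
def missingChords (G : SimpleGraph V) [DecidableRel G.Adj] (e : ZMod N ≃ V) (d : ZMod N) : ℕ :=
  (Finset.univ.filter fun i => ¬ G.Adj (e i) (e (i + d))).card

theorem missingChords_neg (e : ZMod N ≃ V) (d : ZMod N) :
    missingChords G e (-d) = missingChords G e d := by
  refine Finset.card_equiv (Equiv.addRight (-d)) fun i => ?_
  simp [G.adj_comm]

theorem missingChords_shift (e : ZMod N ≃ V) (d r : ZMod N) :
    (Finset.univ.filter fun i => ¬ G.Adj (e (i + r)) (e (i + r + d))).card =
      missingChords G e d :=
  Finset.card_equiv (Equiv.addRight r) fun i => by simp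

theorem missingChords_eq (e : ZMod N ≃ V) {d : ZMod N} (h : ∀ i, ¬ G.Adj (e i) (e (i + d))) :
    missingChords G e d = N := by
  rw [missingChords, Finset.filter_true_of_mem fun i _ => h i, Finset.card_univ, ZMod.card]

end MissingChords

/-! ### From a Hamiltonian cycle to all even lengths. -/

section Bipancyclic

theorem Finset.exists_injOn_nat {V : Type*} (X : Finset V) (hX : X.Nonempty) :
    ∃ a : ℕ → V, Set.InjOn a (Set.Iio X.card) ∧ ∀ k, a k ∈ X := by
  obtain ⟨x₀, hx₀⟩ := hX
  -- The default `x₀` keeps all values in `X`, so membership needs no bound on the index.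
  refine ⟨fun k => if h : k < X.card then X.equivFin.symm ⟨k, h⟩ else x₀, ?_, ?_⟩
  · intro i hi j hj hij
    rw [Set.mem_Iio] at hi hj
    simp only [hi, hj, dif_pos] at hij
    have := X.equivFin.symm.injective (Subtype.ext hij)
    exact Fin.mk.inj_iff.1 this
  · intro k
    dsimp only
    split_ifs
    · exact Subtype.prop _
    · exact hx₀

variable {V : Type*} [Fintype V] [DecidableEq V] {G : SimpleGraph V} {X Y : Finset V}

theorem exists_isHamiltonianEnum_of_complete (hG : IsBalancedBipartition G X Y) {n : ℕ}
    (hX : X.card = n) (hn : 1 ≤ n) (hall : ∀ x ∈ X, ∀ y ∈ Y, G.Adj x y) :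
    ∃ e : ZMod (2 * n) ≃ V, IsHamiltonianEnum G e := by
  have hY : Y.card = n := hG.card_eq ▸ hX
  obtain ⟨a, ha, haX⟩ := X.exists_injOn_nat (Finset.card_pos.1 (by omega))
  obtain ⟨b, hb, hbY⟩ := Y.exists_injOn_nat (Finset.card_pos.1 (by omega))
  rw [hX] at ha
  rw [hY] at hb
  have hne : ∀ i j, a i ≠ b j := fun i j h => hG.notMem (haX i) (h ▸ hbY j)
  refine IsCyclicSequence.exists_isHamiltonianEnum
    (f := fun k => if k % 2 = 0 then a (k / 2) else b (k / 2)) ⟨?_, ?_, ?_⟩ (by omega)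
    (by rw [hG.card_eq_two_mul, hX])
  · intro i hi j hj hij
    rw [Set.mem_Iio] at hi hj
    dsimp only at hij
    split_ifs at hij with h1 h2 h2
    · have := ha (show i / 2 < n by omega) (show j / 2 < n by omega) hij
      omega
    · exact absurd hij (hne _ _)
    · exact absurd hij.symm (hne _ _)
    · have := hb (show i / 2 < n by omega) (show j / 2 < n by omega) hij
      omega
  · intro i _
    rcases Nat.mod_two_eq_zero_or_one i with h | h
    · rw [if_pos h, if_neg (by omega)]
      exact hall _ (haX _) _ (hbY _)
    · rw [if_neg (by omega), if_pos (by omega)]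
      exact (hall _ (haX _) _ (hbY _)).symm
  · rw [if_neg (by omega), if_pos (by omega)]
    exact (hall _ (haX _) _ (hbY _)).symm

variable {N : ℕ}

/-- A shift by `d` along the enumeration `e` exchanges the two sides. -/
def SwapsSides (e : ZMod N ≃ V) (X Y : Finset V) (d : ZMod N) : Prop :=
  ∀ i, (e i ∈ X → e (i + d) ∈ Y) ∧ (e i ∈ Y → e (i + d) ∈ X)

theorem IsHamiltonianEnum.swapsSides (hG : IsBalancedBipartition G X Y) {e : ZMod N ≃ V}
    (he : IsHamiltonianEnum G e) (k : ℕ) : SwapsSides e X Y ((2 * k + 1 : ℕ) : ZMod N) := by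
  have hstep : SwapsSides e X Y 1 := fun i =>
    ⟨fun h => hG.mem_of_adj h (he i), fun h => hG.symm.mem_of_adj h (he i)⟩
  induction k with
  | zero => simpa using hstep
  | succ k ih =>
    intro i
    have heq : i + ((2 * (k + 1) + 1 : ℕ) : ZMod N) = i + ((2 * k + 1 : ℕ) : ZMod N) + 1 + 1 := by
      push_cast; ring
    rw [heq]
    exact ⟨fun h => (hstep _).1 ((hstep _).2 ((ih i).1 h)),
      fun h => (hstep _).2 ((hstep _).1 ((ih i).2 h))⟩

theorem SwapsSides.neg (hG : IsBalancedBipartition G X Y) {e : ZMod N ≃ V} {d : ZMod N}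
    (hd : SwapsSides e X Y d) : SwapsSides e X Y (-d) := by
  intro i
  have h := hd (i + -d)
  rw [neg_add_cancel_right] at h
  exact ⟨fun hi => (hG.mem_or_mem _).resolve_left fun h' => hG.notMem hi (h.1 h'),
    fun hi => (hG.mem_or_mem _).resolve_right fun h' => hG.notMem (h.2 h') hi⟩

variable [NeZero N] [DecidableRel G.Adj]

/-- At a fixed position, distinct spans in `D` lead to distinct vertices of the opposite part, so
the missing ones number at most `X.card` minus the degree. Summing over positions counts each edge
twice. -/
theorem sum_missingChords_add_le (hG : IsBalancedBipartition G X Y) (e : ZMod N ≃ V)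
    (D : Finset (ZMod N)) (hD : ∀ d ∈ D, SwapsSides e X Y d) :
    ∑ d ∈ D, missingChords G e d + 2 * G.edgeFinset.card ≤ N * X.card := by
  have hpt : ∀ i, (D.filter fun d => ¬ G.Adj (e i) (e (i + d))).card + G.degree (e i) ≤
      X.card := by
    intro i
    have hside : ∀ A B : Finset V, IsBalancedBipartition G A B → e i ∈ A →
        (∀ d ∈ D, e (i + d) ∈ B) →
        (D.filter fun d => ¬ G.Adj (e i) (e (i + d))).card + G.degree (e i) ≤ A.card := by
      intro A B hAB hi hB
      rw [← hAB.degree_add_card_filter_not_adj hi, add_comm]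
      refine Nat.add_le_add_left (Finset.card_le_card_of_injOn (fun d => e (i + d)) ?_ ?_) _
      · intro d hd
        rw [Finset.mem_coe, Finset.mem_filter] at hd
        rw [Finset.mem_coe, Finset.mem_filter]
        exact ⟨hB d hd.1, hd.2⟩
      · intro a _ b _ hab
        exact add_left_cancel (e.injective hab)
    rcases hG.mem_or_mem (e i) with hi | hi
    · exact hside X Y hG hi fun d hd => (hD d hd i).1 hi
    · rw [hG.card_eq]
      exact hside Y X hG.symm hi fun d hd => (hD d hd i).2 hi
  have hdeg : ∑ i, G.degree (e i) = 2 * G.edgeFinset.card := by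
    rw [Equiv.sum_comp e fun v => G.degree v, G.sum_degrees_eq_twice_card_edges]
  have hswap : ∑ d ∈ D, missingChords G e d =
      ∑ i, (D.filter fun d => ¬ G.Adj (e i) (e (i + d))).card := by
    simp only [missingChords, Finset.card_filter]
    exact Finset.sum_comm
  rw [hswap, ← hdeg, ← Finset.sum_add_distrib]
  refine (Finset.sum_le_sum fun i _ => hpt i).trans ?_
  rw [Finset.sum_const, Finset.card_univ, ZMod.card, smul_eq_mul]

theorem IsHamiltonianEnum.isBipancyclic (hG : IsBalancedBipartition G X Y) {n : ℕ}
    (hX : X.card = n) (hn : 4 ≤ n) (hedge : n ^ 2 + 4 ≤ G.edgeFinset.card + 2 * n)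
    {e : ZMod (2 * n) ≃ V} (he : IsHamiltonianEnum G e) : IsBipancyclic G := by
  have hNZ : NeZero (2 * n) := ⟨by omega⟩
  have hcast : ∀ a : ℕ, 0 < a → a < 2 * n → (a : ZMod (2 * n)) ≠ 0 := by
    intro a h0 ha h
    have := Nat.le_of_dvd h0 ((ZMod.natCast_eq_zero_iff _ _).1 h)
    omega
  have hself : ((2 * n : ℕ) : ZMod (2 * n)) = 0 := ZMod.natCast_self _
  -- Here `N * X.card = 2n²`, and twice the edge count is at least `2n² - 4n + 8`.
  have hbound : ∀ D : Finset (ZMod (2 * n)), (∀ d ∈ D, SwapsSides e X Y d) →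
      ∑ d ∈ D, missingChords G e d + 8 ≤ 4 * n := by
    intro D hD
    have := sum_missingChords_add_le hG e D hD
    rw [hX] at this
    nlinarith
  have hback : ∀ i : ZMod (2 * n), G.Adj (e (i + (2 * n - 1 : ℕ))) (e (i + (0 : ℕ))) := by
    intro i
    have := he (i + (2 * n - 1 : ℕ))
    rwa [add_assoc, ← Nat.cast_succ, show (2 * n - 1).succ = 2 * n by omega, hself,
      ← Nat.cast_zero] at this
  intro l hl h4 hlV
  rw [hG.card_eq_two_mul, hX] at hlV
  obtain ⟨k, hk⟩ := hl
  have harc : ∀ i : ZMod (2 * n), G.Adj (e (i + (l - 1 : ℕ))) (e (i + (0 : ℕ))) →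
      ∃ (v : V) (c : G.Walk v v), c.IsCycle ∧ c.length = l := fun i hi =>
    (isCyclicSequence_of_reindex e i id (fun j hj => lt_of_lt_of_le hj hlV)
      Function.injective_id.injOn (fun j _ => he.adj_of_eq_add_one i rfl) hi).exists_isCycle
      (by omega)
  rcases hlV.eq_or_lt with rfl | hlt
  · exact harc 0 (hback 0)
  by_contra hno
  -- Any such chord would close an arc of `l` consecutive vertices into a cycle.
  have hmiss : missingChords G e ((l - 1 : ℕ) : ZMod (2 * n)) = 2 * n := by
    refine missingChords_eq e fun i hi => hno (harc i ?_)
    rw [Nat.cast_zero, add_zero]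
    exact hi.symm
  have hodd : ∀ d : ℕ, d % 2 = 1 → SwapsSides e X Y (d : ZMod (2 * n)) := by
    intro d hd
    have := he.swapsSides hG (d / 2)
    rwa [show 2 * (d / 2) + 1 = d by omega] at this
  have hne_neg : ∀ a b : ℕ, ((a + b : ℕ) : ZMod (2 * n)) ≠ 0 →
      (a : ZMod (2 * n)) ≠ -(b : ZMod (2 * n)) := by
    intro a b h h'
    rw [Nat.cast_add, h', neg_add_cancel] at h
    exact h rfl
  -- An antipodal span equals its own negative, so it accounts for only `2n` in `hbound`. The
  -- remaining slack limits every other odd span to `n - 4` missing chords.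
  by_cases hln : l - 1 = n
  · rw [hln] at hmiss
    have hpair : ∀ d : ℕ, d % 2 = 1 → (n : ZMod (2 * n)) ≠ d → (n : ZMod (2 * n)) ≠ -d →
        (d : ZMod (2 * n)) ≠ -d → missingChords G e (d : ZMod (2 * n)) + 4 ≤ n := by
      intro d hd h1 h2 h3
      have := hbound {(n : ZMod (2 * n)), (d : ZMod (2 * n)), -(d : ZMod (2 * n))} (by
        intro d' hd'
        simp only [Finset.mem_insert, Finset.mem_singleton] at hd'
        rcases hd' with rfl | rfl | rfl
        · exact hodd n (by omega)
        · exact hodd d hd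
        · exact (hodd d hd).neg hG)
      rw [Finset.sum_insert (by simp [h1, h2]), Finset.sum_pair h3, missingChords_neg, hmiss]
        at this
      omega
    have h3 := hpair 3 rfl
      (fun h => by
        have := natCast_zmod_injOn (2 * n) (show n < 2 * n by omega) (show 3 < 2 * n by omega) h
        omega)
      (hne_neg _ _ (hcast _ (by omega) (by omega))) (hne_neg _ _ (hcast _ (by omega) (by omega)))
    have h5 := hpair (n + 2) (by omega)
      (fun h => by
        have := natCast_zmod_injOn (2 * n) (show n < 2 * n by omega)
          (show n + 2 < 2 * n by omega) h
        omega)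
      (hne_neg _ _ (by
        rw [show n + (n + 2) = 2 * n + 2 by ring, Nat.cast_add, hself, zero_add]
        exact hcast _ (by omega) (by omega)))
      (hne_neg _ _ (by
        rw [show n + 2 + (n + 2) = 2 * n + 4 by ring, Nat.cast_add, hself, zero_add]
        exact hcast _ (by omega) (by omega)))
    -- Both chords together give the cycle of length `n + 1` through positions `0, 3, 2, 1, n + 3, n
    -- + 4, …, 2n - 1` relative to `i`. One of them is thus missing for each `i`, so there are at
    -- least `2n` gaps where at most `2n - 8` are allowed.
    have hor : ∀ i, ¬ G.Adj (e i) (e (i + (3 : ℕ))) ∨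
        ¬ G.Adj (e (i + 1)) (e (i + 1 + (n + 2 : ℕ))) := by
      intro i
      by_contra hcon
      rw [not_or, not_not, not_not] at hcon
      obtain ⟨hc1, hc2⟩ := hcon
      refine hno ((isCyclicSequence_of_reindex (l := l) e i
        (fun j => if j = 0 then 0 else if j < 4 then 4 - j else n + j - 1) ?_ ?_ ?_
        ?_).exists_isCycle (by omega))
      · intro j hj
        split_ifs <;> omega
      · intro a ha b hb hab
        rw [Set.mem_Iio] at ha hb
        dsimp only at hab
        split_ifs at hab <;> omega
      · intro j hj
        rcases Nat.lt_or_ge j 4 with hj4 | hj4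
        · interval_cases j
          · simpa using hc1
          · exact (he.adj_of_eq_add_one i rfl).symm
          · exact (he.adj_of_eq_add_one i rfl).symm
          · have h1 : i + 1 + ((n + 2 : ℕ) : ZMod (2 * n)) = i + ((n + 4 - 1 : ℕ) : ZMod (2 * n)) := by
              rw [show n + 4 - 1 = 1 + (n + 2) by omega, Nat.cast_add 1, Nat.cast_one, add_assoc]
            rw [h1] at hc2
            simpa using hc2
        · rw [if_neg (by omega), if_neg (by omega), if_neg (by omega), if_neg (by omega)]
          exact he.adj_of_eq_add_one i (by omega)
      · rw [if_neg (by omega), if_neg (by omega), if_pos rfl, hln,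
          show n + n - 1 = 2 * n - 1 by omega]
        exact hback i
    have hcover : 2 * n ≤ missingChords G e ((3 : ℕ) : ZMod (2 * n)) +
        missingChords G e ((n + 2 : ℕ) : ZMod (2 * n)) := by
      rw [← missingChords_shift e ((n + 2 : ℕ) : ZMod (2 * n)) 1, missingChords]
      refine le_trans ?_ (Finset.card_union_le _ _)
      rw [← Finset.filter_or, Finset.filter_true_of_mem fun i _ => hor i, Finset.card_univ,
        ZMod.card]
    omega
  · have hd : ((l - 1 : ℕ) : ZMod (2 * n)) ≠ -((l - 1 : ℕ) : ZMod (2 * n)) := by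
      refine hne_neg _ _ fun h => ?_
      obtain ⟨q, hq⟩ := (ZMod.natCast_eq_zero_iff _ _).1 h
      have hq2 : q < 2 := by
        by_contra hcon
        have : 2 * n * 2 ≤ 2 * n * q := Nat.mul_le_mul_left _ (by omega)
        omega
      interval_cases q <;> omega
    -- The spans `l - 1` and `-(l - 1)` are distinct and contribute `2n` each, exceeding the bound
    -- `4n - 8`.
    have := hbound {((l - 1 : ℕ) : ZMod (2 * n)), -((l - 1 : ℕ) : ZMod (2 * n))} (by
      intro d' hd'
      simp only [Finset.mem_insert, Finset.mem_singleton] at hd'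
      rcases hd' with rfl | rfl
      · exact hodd _ (by omega)
      · exact (hodd _ (by omega)).neg hG)
    rw [Finset.sum_pair hd, missingChords_neg, hmiss] at this
    omega

end Bipancyclic

/-! ### Closure induction and conclusion. -/

/-- Induction towards larger graphs. The edge-count equality is carried in the conclusion so that
the extremal alternative is impossible after an edge has been added. -/
theorem exists_isHamiltonianEnum_or_isExtremalBetween {V : Type*} [Fintype V] [DecidableEq V]
    {X Y : Finset V} {n : ℕ} (hX : X.card = n) (hn : 4 ≤ n) (G : SimpleGraph V)
    [hdec : DecidableRel G.Adj] (hG : IsBalancedBipartition G X Y) (hδ : ∀ v, 2 ≤ G.degree v)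
    (he : n ^ 2 + 4 ≤ G.edgeFinset.card + 2 * n) :
    (∃ e : ZMod (2 * n) ≃ V, IsHamiltonianEnum G e) ∨
      (IsExtremalBetween G X Y ∨ IsExtremalBetween G Y X) ∧
        G.edgeFinset.card + 2 * n = n ^ 2 + 4 := by
  revert hdec hG hδ he
  induction G using WellFoundedGT.induction with
  | ind G ih =>
    intro _ hG hδ he
    by_cases hall : ∀ x ∈ X, ∀ y ∈ Y, G.Adj x y
    · exact Or.inl (exists_isHamiltonianEnum_of_complete hG hX (by omega) hall)
    by_cases hdeg : ∀ x ∈ X, ∀ y ∈ Y, ¬ G.Adj x y → G.degree x + G.degree y ≤ n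
    · push Not at hall
      exact Or.inr (isExtremalBetween_of_forall_degree_add_degree_le hG hX hn hδ he hdeg hall)
    push Not at hdeg
    obtain ⟨x, hx, y, hy, hna, hsum⟩ := hdeg
    have hxy : x ≠ y := fun h => hG.notMem hx (h ▸ hy)
    have hcard : ∀ H : SimpleGraph V, H = G ⊔ SimpleGraph.edge x y → ∀ [DecidableRel H.Adj],
        H.edgeFinset.card = G.edgeFinset.card + 1 := by
      rintro _ rfl _
      convert G.card_edgeFinset_sup_edge hna hxy
    have hle : G ≤ G ⊔ SimpleGraph.edge x y := le_sup_left
    have hlt : G < G ⊔ SimpleGraph.edge x y :=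
      lt_of_le_not_ge hle fun h => hna (h (by simp [SimpleGraph.edge_adj, hxy]))
    rcases ih _ hlt (hG.sup_edge hx hy) (fun v => (hδ v).trans (SimpleGraph.degree_le_of_le hle))
      (by rw [hcard _ rfl]; omega) with ⟨e, h⟩ | ⟨-, h⟩
    · exact Or.inl (exists_isHamiltonianEnum_of_sup_edge (by omega)
        (by rw [hG.card_eq_two_mul, hX]) hG hx hy (by omega) h)
    · rw [hcard _ rfl] at h
      omega

theorem lemma6 {V : Type*} [Fintype V] [DecidableEq V] (G : SimpleGraph V) [DecidableRel G.Adj]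
    (X Y : Finset V) (n : ℕ) (hn : 4 ≤ n)
    (hG : IsBalancedBipartition G X Y) (hV : Fintype.card V = 2 * n)
    (hδ : 2 ≤ G.minDegree)
    (he : (n : ℤ) ^ 2 - 2 * (n : ℤ) + 4 ≤ (G.edgeFinset.card : ℤ)) :
    IsBipancyclic G ∨ Nonempty (G ≃g graphG1 n) := by
  have hX : X.card = n := by
    have := hG.card_eq_two_mul
    omega
  have hedge : n ^ 2 + 4 ≤ G.edgeFinset.card + 2 * n := by
    zify
    linarith
  rcases exists_isHamiltonianEnum_or_isExtremalBetween hX hn G hG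
    (fun v => hδ.trans (G.minDegree_le_degree v)) hedge with ⟨e, h⟩ | ⟨h | h, -⟩
  · exact Or.inl (h.isBipancyclic hG hX hn hedge)
  · exact Or.inr (h.nonempty_iso hG (isBalancedBipartition_graphG1 n) (by simp [hX])
      (isExtremalBetween_graphG1 (by omega)))
  · exact Or.inr (h.nonempty_iso hG.symm (isBalancedBipartition_graphG1 n)
      (by simp [← hG.card_eq, hX]) (isExtremalBetween_graphG1 (by omega)))
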